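/- For $a>0$ and $t>0$ let $$\eta_a(t)=\sum_{m=0}^{\infty}\frac{(-1)^m}{(am+1)^t},$$ understood as the limit of the partial sums; the series converges for every $t>0$ and $\eta_a$ is of class $C^\infty$ on $(0,\infty)$. Write $\eta_a^{(k)}$ for its $k$-th derivative. For $k,n,l\in\{0,1,2,\dots\}$ put $$\varphi_{a,t,k}(l)=\frac{\log^k(al+1)}{(al+1)^t},\qquad c_{a,t,k}(n)=(-1)^{n+k}\sum_{l=0}^{n}\binom nl\bigl(\Delta^{n-l}\varphi_{a,t,k}\bigr)(l),$$ where $\Delta f(l)=f(l+1)-f(l)$, $\Delta^m$ is the $m$-th iterate of $\Delta$, and $\log^0(\cdot)=1$ (also at argument $1$). For $N\in\{1,2,3,\dots\}$ define the truncated estimator $$\widehat\eta_{a,N}^{(k)}(t)=\frac23\sum_{n=0}^{N-1}\frac{c_{a,t,k}(n)}{3^n}.$$ Then for all $a,t>0$, all integers $k\ge 0$ and $N\ge 1$, $$\bigl|\eta_a^{(k)}(t)-\widehat\eta_{a,N}^{(k)}(t)\bigr|\le\frac43\sum_{n=N}^{\infty}\frac1{3^n}\binom{n+k}{k}\log^k\bigl(a(n\wedge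 k)+1\bigr),$$ where $n\wedge k=\min(n,k)$ and the series on the right converges. In particular, for fixed $a$ and $k$ the error is $O(N^k3^{-N})$ as $N\to\infty$, uniformly in $t$: there is a constant $C$ depending only on $a$ and $k$ such that for all $t>0$ and all $N\ge1$ $$\bigl|\eta_a^{(k)}(t)-\widehat\eta_{a,N}^{(k)}(t)\bigr|\le C\,N^k\,3^{-N}.$$ -/

import Mathlib

open Filter Topology
open scoped ContDiff

namespace DirichletEta

/-- Partial sums `∑_{m < M} (-1)^m / (a m + 1)^t` of the alternating series. -/
noncomputable def etaPartial (a t : ℝ) (M : ℕ) : ℝ :=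
  ∑ m ∈ Finset.range M, (-1 : ℝ) ^ m / (a * (m : ℝ) + 1) ^ t

/-- `η_a(t) = ∑_{m ≥ 0} (-1)^m / (a m + 1)^t`, as the limit of the partial sums
(for `0 < t ≤ 1` the series converges only conditionally). -/
noncomputable def eta (a t : ℝ) : ℝ :=
  limUnder atTop (etaPartial a t)

/-- The basic discrete function `φ_{a,t,k}(l) = log^k (a l + 1) / (a l + 1)^t`. -/
noncomputable def phi (a t : ℝ) (k l : ℕ) : ℝ :=
  Real.log (a * (l : ℝ) + 1) ^ k / (a * (l : ℝ) + 1) ^ t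

/-- `c_{a,t,k}(n) = (-1)^{n+k} ∑_{l=0}^n C(n,l) (Δ^{n-l} φ_{a,t,k})(l)`, with `Δ = fwdDiff 1` the
forward difference `Δ f (l) = f (l+1) - f l` on `ℕ`. -/
noncomputable def coeff (a t : ℝ) (k n : ℕ) : ℝ :=
  (-1 : ℝ) ^ (n + k) *
    ∑ l ∈ Finset.range (n + 1), (n.choose l : ℝ) * (fwdDiff (1 : ℕ))^[n - l] (phi a t k) l

/-- The truncated estimator `(2/3) ∑_{n=0}^{N-1} c_{a,t,k}(n) / 3^n`. -/
noncomputable def etaTrunc (a t : ℝ) (k N : ℕ) : ℝ :=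
  2 / 3 * ∑ n ∈ Finset.range N, coeff a t k n / 3 ^ n

/-- The term `3^{-n} C(n+k,k) log^k (a (n ∧ k) + 1)` of the error bound (`log^0 = 1`). -/
noncomputable def boundTerm (a : ℝ) (k n : ℕ) : ℝ :=
  1 / 3 ^ n * ((n + k).choose k : ℝ) * Real.log (a * ((min n k : ℕ) : ℝ) + 1) ^ k

end DirichletEta

/-! Write `E` for the shift, `D = 1 - E` and `T = 1 - 2E`. Since `Δ + E = -T`, the coefficient is
`c(n) = (-1)^k (T^n φ_k)(0)`. As `1 - T/3 = (2/3)(1 + E)`, the alternating sum `(1 + E)⁻¹ φ` is the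
Neumann series `(2/3) ∑ 3⁻ⁿ Tⁿ φ`, and only `|Tⁿ φ_k (0)|` needs bounding, uniformly in `t`. For `k
= 0`, `φ_0` is completely monotone, so `T = D - E` gives `|Tⁿ φ_0| ≤ (D + E)ⁿ φ_0 = φ_0`. Each
logarithm is then a multiplier whose increments are completely monotone; the product rule `T(fg) =
Ef · Tg + Df · g` bounds its cost (`abs_eulerStep_iterate_mul_le`). Induction on `k` gives the
bounds needed to differentiate the accelerated series termwise and to estimate its tail. -/

namespace DirichletEta

/-! ### Euler steps on completely monotone sequences -/

/-- The operator `1 - E`, with `E` the shift on sequences. -/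
def bwdStep (f : ℕ → ℝ) (l : ℕ) : ℝ := f l - f (l + 1)

/-- The operator `1 - 2E`, with `E` the shift on sequences. -/
def eulerStep (f : ℕ → ℝ) (l : ℕ) : ℝ := f l - 2 * f (l + 1)

/-- The shift on sequences. -/
def shift (f : ℕ → ℝ) (l : ℕ) : ℝ := f (l + 1)

/-- All iterated differences `(1 - E)^j p` are nonnegative. -/
def CompletelyMonotone (p : ℕ → ℝ) : Prop := ∀ j l, 0 ≤ bwdStep^[j] p l

theorem bwdStep_iterate_shift (n : ℕ) (f : ℕ → ℝ) (l : ℕ) :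
    bwdStep^[n] (shift f) l = bwdStep^[n] f (l + 1) := by
  induction n generalizing f with
  | zero => rfl
  | succ n ih => exact ih (bwdStep f)

theorem eulerStep_iterate_shift (n : ℕ) (f : ℕ → ℝ) (l : ℕ) :
    eulerStep^[n] (shift f) l = eulerStep^[n] f (l + 1) := by
  induction n generalizing f with
  | zero => rfl
  | succ n ih => exact ih (eulerStep f)

theorem eulerStep_iterate_add (n : ℕ) (f g : ℕ → ℝ) :
    eulerStep^[n] (f + g) = eulerStep^[n] f + eulerStep^[n] g := by
  induction n generalizing f g with
  | zero => rfl
  | succ n ih =>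
    have : eulerStep (f + g) = eulerStep f + eulerStep g := by
      funext l; simp only [eulerStep, Pi.add_apply]; ring
    simp only [Function.iterate_succ_apply, this, ih]

theorem eulerStep_iterate_neg (n : ℕ) (f : ℕ → ℝ) :
    eulerStep^[n] (-f) = -eulerStep^[n] f := by
  induction n generalizing f with
  | zero => rfl
  | succ n ih =>
    have : eulerStep (-f) = -eulerStep f := by
      funext l; simp only [eulerStep, Pi.neg_apply]; ring
    simp only [Function.iterate_succ_apply, this, ih]

theorem eulerStep_mul (f g : ℕ → ℝ) :
    eulerStep (f * g) = shift f * eulerStep g + bwdStep f * g := by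
  funext l
  simp only [eulerStep, shift, bwdStep, Pi.mul_apply, Pi.add_apply]
  ring

theorem eulerStep_eq (f : ℕ → ℝ) : eulerStep f = bwdStep f + -shift f := by
  funext l
  simp only [eulerStep, shift, bwdStep, Pi.neg_apply, Pi.add_apply]
  ring

namespace CompletelyMonotone

variable {p : ℕ → ℝ}

theorem nonneg (hp : CompletelyMonotone p) (l : ℕ) : 0 ≤ p l := hp 0 l

theorem shift (hp : CompletelyMonotone p) : CompletelyMonotone (shift p) := fun j l => by
  rw [bwdStep_iterate_shift]
  exact hp j (l + 1)

theorem bwdStep (hp : CompletelyMonotone p) : CompletelyMonotone (bwdStep p) :=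
  fun j l => hp (j + 1) l

theorem abs_eulerStep_iterate_le (hp : CompletelyMonotone p) (n l : ℕ) :
    |eulerStep^[n] p l| ≤ p l := by
  induction n generalizing p with
  | zero => exact (abs_of_nonneg (hp.nonneg l)).le
  | succ n ih =>
    have h1 := ih hp.bwdStep
    have h2 := ih hp.shift
    rw [Function.iterate_succ_apply, eulerStep_eq, eulerStep_iterate_add, eulerStep_iterate_neg]
    simp only [Pi.add_apply, Pi.neg_apply]
    refine (abs_add_le _ _).trans ?_
    rw [abs_neg]
    simp only [DirichletEta.bwdStep, DirichletEta.shift] at h1 h2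
    linarith

/-- In the product rule both `Ep` and `Dp` are again completely monotone, and their values at 0 add
up to `p 0`. -/
theorem abs_eulerStep_iterate_mul_le (hp : CompletelyMonotone p) {A : ℝ} (n : ℕ) (q : ℕ → ℝ)
    (hq : ∀ i ≤ n, |eulerStep^[i] q 0| ≤ A) : |eulerStep^[n] (p * q) 0| ≤ p 0 * A := by
  induction n generalizing p q with
  | zero =>
    simp only [Function.iterate_zero, id, Pi.mul_apply, abs_mul, abs_of_nonneg (hp.nonneg 0)]
    exact mul_le_mul_of_nonneg_left (hq 0 le_rfl) (hp.nonneg 0)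
  | succ n ih =>
    have h1 := ih hp.shift (eulerStep q) fun i hi => hq (i + 1) (by omega)
    have h2 := ih hp.bwdStep q fun i hi => hq i (by omega)
    rw [Function.iterate_succ_apply, eulerStep_mul, eulerStep_iterate_add]
    refine (abs_add_le _ _).trans ?_
    simp only [DirichletEta.bwdStep, DirichletEta.shift] at h1 h2
    linarith

end CompletelyMonotone

/-- The term `Dh · q` costs `(h 1 - h 0) A` by the completely monotone case; the term `Eh · Tq` is
the induction hypothesis for the shifted `h`. The increments telescope to `h n - h 0`. -/
theorem abs_eulerStep_iterate_mul_le {h : ℕ → ℝ} (h0 : ∀ l, 0 ≤ h l)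
    (hh : CompletelyMonotone (-bwdStep h)) {A : ℝ} (n : ℕ) (q : ℕ → ℝ)
    (hq : ∀ i < n, |eulerStep^[i] q 0| ≤ A) :
    |eulerStep^[n] (h * q) 0| ≤ h n * |eulerStep^[n] q 0| + (h n - h 0) * A := by
  induction n generalizing h q A with
  | zero => simp [abs_mul, abs_of_nonneg (h0 0)]
  | succ n ih =>
    have e : bwdStep h * q = -((-bwdStep h) * q) := by ring
    have e' : -bwdStep (shift h) = shift (-bwdStep h) := rfl
    have h1 := ih (h := shift h) (fun l => h0 _) (e' ▸ hh.shift) (eulerStep q)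
      fun i hi => hq (i + 1) (by omega)
    have h2 := hh.abs_eulerStep_iterate_mul_le n q fun i hi => hq i (by omega)
    rw [Function.iterate_succ_apply, eulerStep_mul, eulerStep_iterate_add, e,
      eulerStep_iterate_neg]
    refine (abs_add_le _ _).trans ?_
    simp only [Pi.neg_apply, abs_neg]
    simp only [bwdStep, shift, Pi.neg_apply] at h1 h2
    rw [Function.iterate_succ_apply]
    linarith

/-! ### The coefficients as Euler steps -/

/-- Binomial theorem for the commuting operators `Δ` and `E`, applied to `(-1)ⁿ(Δ + E)ⁿ`. -/
theorem fwdDiff_binomial_sum (n : ℕ) (f : ℕ → ℝ) (x : ℕ) :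
    (-1 : ℝ) ^ n * ∑ l ∈ Finset.range (n + 1), (n.choose l : ℝ) * (fwdDiff (1 : ℕ))^[n - l] f (x + l)
      = eulerStep^[n] f x := by
  induction n generalizing f x with
  | zero => simp
  | succ n ih =>
    have e : eulerStep f = -(shift f) + -(fwdDiff 1 f) := by
      funext l; simp only [eulerStep, shift, fwdDiff, Pi.add_apply, Pi.neg_apply]; ring
    have h1 : ∑ l ∈ Finset.range (n + 1), (n.choose l : ℝ) *
        (fwdDiff (1 : ℕ))^[n - l] (fwdDiff 1 f) (x + l) =
        ∑ l ∈ Finset.range (n + 1), (n.choose (l + 1) : ℝ) *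
          (fwdDiff (1 : ℕ))^[n - l] f (x + (l + 1)) + (fwdDiff (1 : ℕ))^[n + 1] f x := by
      have h2 := Finset.sum_range_succ' (fun l => (n.choose l : ℝ) *
        (fwdDiff (1 : ℕ))^[n + 1 - l] f (x + l)) (n + 1)
      simp only [Nat.add_sub_add_right, Nat.choose_zero_right, Nat.cast_one, one_mul,
        Nat.sub_zero, add_zero] at h2
      rw [← h2, Finset.sum_range_succ _ (n + 1), Nat.choose_succ_self]
      simp only [Nat.cast_zero, zero_mul, add_zero]
      refine Finset.sum_congr rfl fun l hl => ?_
      rw [Finset.mem_range] at hl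
      rw [show n + 1 - l = (n - l) + 1 by omega, Function.iterate_succ_apply]
    rw [Function.iterate_succ_apply, e, eulerStep_iterate_add, eulerStep_iterate_neg,
      eulerStep_iterate_neg]
    simp only [Pi.add_apply, Pi.neg_apply]
    rw [eulerStep_iterate_shift, ← ih f, ← ih (fwdDiff 1 f), h1, Finset.sum_range_succ']
    simp only [Nat.choose_succ_succ, Nat.add_sub_add_right, Nat.cast_add, add_mul,
      Finset.sum_add_distrib, Nat.choose_zero_right, Nat.cast_one, one_mul, Nat.sub_zero, add_zero,
      add_right_comm x 1, ← add_assoc x]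
    ring

theorem coeff_eq (a t : ℝ) (k n : ℕ) :
    coeff a t k n = (-1) ^ k * eulerStep^[n] (phi a t k) 0 := by
  rw [← fwdDiff_binomial_sum, coeff, pow_add]
  simp only [zero_add]
  ring

/-! ### Complete monotonicity of powers and of log increments -/

open MeasureTheory Set

/-- Applying `1 - E` to a moment sequence replaces the weight `w` by `w (1 - x)`, which is still
nonnegative. -/
theorem integral_mul_pow_completelyMonotone {μ : Measure ℝ} {x : ℝ → ℝ} (hx : Measurable x)
    (hx0 : ∀ᵐ u ∂μ, 0 ≤ x u ∧ x u ≤ 1) {w : ℝ → ℝ} (hw : Integrable w μ) (hw0 : ∀ᵐ u ∂μ, 0 ≤ w u) :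
    CompletelyMonotone fun l => ∫ u, w u * x u ^ l ∂μ := by
  have hint : ∀ {w : ℝ → ℝ}, Integrable w μ → ∀ l : ℕ, Integrable (fun u => w u * x u ^ l) μ := by
    intro w hw l
    refine hw.mul_bdd (c := 1) (hx.pow_const l).aestronglyMeasurable ?_
    filter_upwards [hx0] with u hu
    rw [Real.norm_eq_abs, abs_of_nonneg (pow_nonneg hu.1 _)]
    exact pow_le_one₀ hu.1 hu.2
  intro j
  induction j generalizing w with
  | zero =>
    refine fun l => integral_nonneg_of_ae ?_
    filter_upwards [hx0, hw0] with u hu hwu using mul_nonneg hwu (pow_nonneg hu.1 _)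
  | succ j ih =>
    have e : bwdStep (fun l => ∫ u, w u * x u ^ l ∂μ) =
        fun l => ∫ u, (w u - w u * x u ^ 1) * x u ^ l ∂μ := by
      funext l
      rw [bwdStep, ← integral_sub (hint hw l) (hint hw (l + 1))]
      congr 1; funext u; ring
    intro l
    rw [Function.iterate_succ_apply, e]
    refine ih (hw.sub (hint hw 1)) ?_ l
    filter_upwards [hx0, hw0] with u hu hwu
    change 0 ≤ w u - w u * x u ^ 1
    nlinarith [mul_nonneg hwu (sub_nonneg.2 hu.2)]

/-- By the Gamma integral these are moments of `exp (-a u)` with weight `exp (-u) u^(t-1) / Γ(t)`.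
-/
theorem completelyMonotone_rpow_neg {a t : ℝ} (ha : 0 < a) (ht : 0 < t) :
    CompletelyMonotone fun l => 1 / (a * (l : ℝ) + 1) ^ t := by
  have hG := Real.Gamma_pos_of_pos ht
  have key := integral_mul_pow_completelyMonotone (μ := volume.restrict (Ioi 0))
    (x := fun u => Real.exp (-(a * u))) (by fun_prop)
    (w := fun u => Real.exp (-u) * u ^ (t - 1) / Real.Gamma t)
    (by
      filter_upwards [ae_restrict_mem measurableSet_Ioi] with u hu
      exact ⟨(Real.exp_pos _).le, Real.exp_le_one_iff.2 (by have : 0 < u := hu; nlinarith)⟩)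
    ((Real.GammaIntegral_convergent ht).div_const _)
    (by
      filter_upwards [ae_restrict_mem measurableSet_Ioi] with u hu
      have : 0 < u := hu
      positivity)
  convert key using 2 with l
  have hl : 0 < a * (l : ℝ) + 1 := by positivity
  have e : ∀ u : ℝ, Real.exp (-u) * u ^ (t - 1) / Real.Gamma t * Real.exp (-(a * u)) ^ l =
      u ^ (t - 1) * Real.exp (-((a * (l : ℝ) + 1) * u)) / Real.Gamma t := by
    intro u
    rw [← Real.exp_nat_mul, show -((a * (l : ℝ) + 1) * u) = -u + l * -(a * u) by ring, Real.exp_add]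
    ring
  simp_rw [e]
  rw [integral_div, Real.integral_rpow_mul_exp_neg_mul_Ioi ht hl, mul_div_cancel_right₀ _ hG.ne',
    Real.div_rpow zero_le_one hl.le, Real.one_rpow]

theorem CompletelyMonotone.of_tendsto {p : ℕ → ℝ} {F : Filter ℝ} [F.NeBot] {q : ℝ → ℕ → ℝ}
    (hq : ∀ᶠ s in F, CompletelyMonotone (q s)) (h : ∀ l, Tendsto (fun s => q s l) F (𝓝 (p l))) :
    CompletelyMonotone p := by
  intro j
  induction j generalizing p q with
  | zero => exact fun l => ge_of_tendsto (h l) (hq.mono fun s hs => hs 0 l)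
  | succ j ih =>
    exact ih (hq.mono fun s hs => hs.bwdStep) fun l => (h l).sub (h (l + 1))

theorem CompletelyMonotone.div_const {p : ℕ → ℝ} (hp : CompletelyMonotone p) {s : ℝ} (hs : 0 < s) :
    CompletelyMonotone fun l => p l / s := by
  intro j
  induction j generalizing p with
  | zero => exact fun l => div_nonneg (hp 0 l) hs.le
  | succ j ih =>
    have : DirichletEta.bwdStep (fun l => p l / s) =
        fun l => DirichletEta.bwdStep p l / s := by
      funext l; simp only [DirichletEta.bwdStep]; ring
    intro l
    rw [Function.iterate_succ_apply, this]
    exact ih hp.bwdStep l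

/-- `-log x` is the limit of `(x^(-s) - 1) / s` as `s → 0+`; the constant disappears under `1 - E`,
and complete monotonicity passes to pointwise limits. -/
theorem completelyMonotone_log {a : ℝ} (ha : 0 < a) :
    CompletelyMonotone (-bwdStep fun l => Real.log (a * (l : ℝ) + 1)) := by
  refine CompletelyMonotone.of_tendsto (F := 𝓝[>] (0 : ℝ))
    (q := fun s l => bwdStep (fun l => 1 / (a * (l : ℝ) + 1) ^ s) l / s) ?_ ?_
  · filter_upwards [self_mem_nhdsWithin] with s hs
    exact (completelyMonotone_rpow_neg ha hs).bwdStep.div_const hs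
  · have hlim : ∀ l : ℕ, Tendsto (fun s : ℝ => (1 / (a * (l : ℝ) + 1) ^ s - 1) / s) (𝓝[>] 0)
        (𝓝 (-Real.log (a * (l : ℝ) + 1))) := by
      intro l
      have hl : 0 < a * (l : ℝ) + 1 := by positivity
      have hd : HasDerivAt (fun s : ℝ => (a * (l : ℝ) + 1) ^ (-s))
          (-Real.log (a * (l : ℝ) + 1)) 0 := by
        have := (hasDerivAt_neg (0 : ℝ)).const_rpow hl
        simpa using this
      have := hd.tendsto_slope_zero_right
      refine this.congr fun s => ?_
      rw [Real.rpow_neg hl.le, zero_add, neg_zero, Real.rpow_zero, smul_eq_mul, one_div]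
      ring
    intro l
    have := (hlim l).sub (hlim (l + 1))
    simp only [Pi.neg_apply, bwdStep]
    convert this using 2
    · ring
    · ring

/-! ### Bounds for the coefficients -/

theorem phi_zero (a t : ℝ) : phi a t 0 = fun l : ℕ => 1 / (a * (l : ℝ) + 1) ^ t := by
  funext l; simp [phi]

theorem phi_succ (a t : ℝ) (k : ℕ) :
    phi a t (k + 1) = (fun l : ℕ => Real.log (a * (l : ℝ) + 1)) * phi a t k := by
  funext l; simp only [phi, Pi.mul_apply]; ring

theorem log_nonneg_of_pos {a : ℝ} (ha : 0 < a) (l : ℕ) : 0 ≤ Real.log (a * (l : ℝ) + 1) :=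
  Real.log_nonneg (by have : 0 ≤ a * (l : ℝ) := by positivity
                      linarith)

theorem log_mono {a : ℝ} (ha : 0 < a) {m n : ℕ} (h : m ≤ n) :
    Real.log (a * (m : ℝ) + 1) ≤ Real.log (a * (n : ℝ) + 1) := by
  have : (m : ℝ) ≤ n := by exact_mod_cast h
  exact Real.log_le_log (by positivity) (by gcongr)

theorem abs_eulerStep_phi_zero_le {a t : ℝ} (ha : 0 < a) (ht : 0 < t) (n l : ℕ) :
    |eulerStep^[n] (phi a t 0) l| ≤ phi a t 0 l := by
  rw [phi_zero]
  exact (completelyMonotone_rpow_neg ha ht).abs_eulerStep_iterate_le n l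

theorem phi_zero_zero (a t : ℝ) : phi a t 0 0 = 1 := by simp [phi]

theorem abs_eulerStep_phi_succ_le {a : ℝ} (ha : 0 < a) (t : ℝ) (k n : ℕ) {A B : ℝ}
    (hA : |eulerStep^[n] (phi a t k) 0| ≤ A) (hB : ∀ i < n, |eulerStep^[i] (phi a t k) 0| ≤ B) :
    |eulerStep^[n] (phi a t (k + 1)) 0| ≤ Real.log (a * (n : ℝ) + 1) * (A + B) := by
  have h := abs_eulerStep_iterate_mul_le (log_nonneg_of_pos ha) (completelyMonotone_log ha) n
    (phi a t k) hB
  rw [← phi_succ] at h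
  have := mul_le_mul_of_nonneg_left hA (log_nonneg_of_pos ha n)
  simp only [Nat.cast_zero, mul_zero, zero_add, Real.log_one, sub_zero] at h
  linarith

theorem abs_eulerStep_phi_le_two_pow {a t : ℝ} (ha : 0 < a) (ht : 0 < t) (k n : ℕ) :
    |eulerStep^[n] (phi a t k) 0| ≤ 2 ^ k * Real.log (a * (n : ℝ) + 1) ^ k := by
  induction k generalizing n with
  | zero => simpa [phi_zero_zero] using abs_eulerStep_phi_zero_le ha ht n 0
  | succ k ih =>
    refine (abs_eulerStep_phi_succ_le ha t k n (ih n)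
      (B := 2 ^ k * Real.log (a * (n : ℝ) + 1) ^ k) fun i hi => (ih i).trans ?_).trans
      (le_of_eq (by ring))
    have := log_mono ha hi.le
    have := log_nonneg_of_pos ha i
    gcongr

theorem abs_eulerStep_phi_le_choose {a t : ℝ} (ha : 0 < a) (ht : 0 < t) (k n : ℕ) :
    |eulerStep^[n] (phi a t k) 0| ≤
      2 * ((n + k).choose k : ℝ) * Real.log (a * (n : ℝ) + 1) ^ k := by
  induction k generalizing n with
  | zero =>
    have : |eulerStep^[n] (phi a t 0) 0| ≤ 1 := by
      simpa [phi_zero_zero] using abs_eulerStep_phi_zero_le ha ht n 0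
    simp only [Nat.choose_zero_right, Nat.cast_one, pow_zero]
    linarith
  | succ k ih =>
    cases n with
    | zero => simp [phi]
    | succ n =>
      have hL := log_nonneg_of_pos ha (n + 1)
      -- Pascal's rule twice. The lower-order bound is needed only for `i < n + 1`, hence `(n +
      -- k).choose k` in the second term.
      have hc : (n + 1 + k).choose k + (n + k).choose k ≤ (n + 1 + (k + 1)).choose (k + 1) := by
        have h1 : (n + 1 + (k + 1)).choose (k + 1) =
            (n + 1 + k).choose k + (n + 1 + k).choose (k + 1) := Nat.choose_succ_succ _ _
        have h2 : (n + 1 + k).choose (k + 1) = (n + k).choose k + (n + k).choose (k + 1) := by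
          rw [show n + 1 + k = n + k + 1 by ring, Nat.choose_succ_succ]
        omega
      have hc' : ((n + 1 + k).choose k : ℝ) + ((n + k).choose k : ℝ) ≤
          ((n + 1 + (k + 1)).choose (k + 1) : ℝ) := by exact_mod_cast hc
      refine (abs_eulerStep_phi_succ_le ha t k (n + 1) (ih (n + 1))
        (B := 2 * ((n + k).choose k : ℝ) * Real.log (a * ((n + 1 : ℕ) : ℝ) + 1) ^ k)
        fun i hi => (ih i).trans ?_).trans ?_
      · have h1 := log_mono ha hi.le
        have h2 := log_nonneg_of_pos ha i
        have h3 : (i + k).choose k ≤ (n + k).choose k := Nat.choose_le_choose k (by omega)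
        gcongr
      · calc _ = 2 * (((n + 1 + k).choose k : ℝ) + ((n + k).choose k : ℝ)) *
              Real.log (a * ((n + 1 : ℕ) : ℝ) + 1) ^ (k + 1) := by ring
          _ ≤ _ := by gcongr

/-- The inductive step rests on `(1 + 1/k)^k ≥ 2`, from Bernoulli's inequality. -/
theorem two_pow_mul_factorial_le (k : ℕ) (hk : 1 ≤ k) : 2 ^ k * k.factorial ≤ 2 * k ^ k := by
  induction k, hk using Nat.le_induction with
  | base => simp
  | succ k hk ih =>
    have h1 : 2 * k ^ k ≤ (k + 1) ^ k := by
      have := one_add_mul_le_pow (a := (1 / k : ℝ)) (by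
        have : (0 : ℝ) ≤ 1 / k := by positivity
        linarith) k
      have hk0 : (0 : ℝ) < k := by exact_mod_cast hk
      rw [mul_one_div_cancel hk0.ne', show (1 + 1 / k : ℝ) = (k + 1) / k by field_simp, div_pow,
        le_div_iff₀ (by positivity)] at this
      have h2 : (2 * (k : ℝ) ^ k) ≤ ((k : ℝ) + 1) ^ k := by linarith
      exact_mod_cast h2
    rw [Nat.factorial_succ]
    calc 2 ^ (k + 1) * ((k + 1) * k.factorial) = 2 * (k + 1) * (2 ^ k * k.factorial) := by ring
      _ ≤ 2 * (k + 1) * (2 * k ^ k) := by gcongr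
      _ ≤ 2 * (k + 1) * (k + 1) ^ k := by gcongr
      _ = _ := by ring

theorem pow_le_factorial_mul_choose (n k : ℕ) : n ^ k ≤ k.factorial * (n + k).choose k := by
  rw [← Nat.ascFactorial_eq_factorial_mul_choose]
  exact (Nat.pow_le_pow_left (Nat.le_succ n) k).trans (Nat.pow_succ_le_ascFactorial (n + 1) k)

/-- Bernoulli with exponent `n / k ≥ 1`: `1 + a n ≤ (1 + a k)^(n/k)`. -/
theorem mul_log_le {a : ℝ} (ha : 0 < a) {k n : ℕ} (hk : 1 ≤ k) (hkn : k ≤ n) :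
    k * Real.log (a * (n : ℝ) + 1) ≤ n * Real.log (a * (k : ℝ) + 1) := by
  have hk0 : (0 : ℝ) < k := by exact_mod_cast hk
  have hkn' : (k : ℝ) ≤ n := by exact_mod_cast hkn
  have hpos : 0 < a * (k : ℝ) + 1 := by positivity
  have h := one_add_mul_self_le_rpow_one_add (s := a * k) (p := n / k)
    (by have : 0 ≤ a * (k : ℝ) := by positivity
        linarith) ((one_le_div hk0).2 hkn')
  have e : 1 + (n / k : ℝ) * (a * k) = a * n + 1 := by field_simp; ring
  rw [e, add_comm 1] at h
  have h2 := Real.log_le_log (by positivity) h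
  rw [Real.log_rpow hpos, div_mul_eq_mul_div, le_div_iff₀ hk0] at h2
  linarith

/-- For `n ≤ k` this is the binomial bound. For `n > k ≥ 1` the `2^k` bound is better: trading `log
(a n + 1)` for `log (a k + 1)` costs `(n/k)^k`, and `2^k n^k ≤ 2^k k! C(n+k,k) ≤ 2 k^k C(n+k,k)`. -/
theorem abs_eulerStep_phi_le {a t : ℝ} (ha : 0 < a) (ht : 0 < t) (k n : ℕ) :
    |eulerStep^[n] (phi a t k) 0| ≤
      2 * ((n + k).choose k : ℝ) * Real.log (a * ((min n k : ℕ) : ℝ) + 1) ^ k := by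
  rcases le_or_gt n k with h | h
  · rw [min_eq_left h]
    exact abs_eulerStep_phi_le_choose ha ht k n
  rw [min_eq_right h.le]
  rcases Nat.eq_zero_or_pos k with rfl | hk
  · simpa using abs_eulerStep_phi_le_choose ha ht 0 n
  refine (abs_eulerStep_phi_le_two_pow ha ht k n).trans ?_
  have hk0 : (0 : ℝ) < k := by exact_mod_cast hk
  have hL := log_nonneg_of_pos ha k
  have hLn := log_nonneg_of_pos ha n
  have h1 : (k : ℝ) ^ k * Real.log (a * (n : ℝ) + 1) ^ k ≤
      (n : ℝ) ^ k * Real.log (a * (k : ℝ) + 1) ^ k := by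
    rw [← mul_pow, ← mul_pow]
    exact pow_le_pow_left₀ (by positivity) (mul_log_le ha hk h.le) k
  have h2 : (n : ℝ) ^ k ≤ k.factorial * (n + k).choose k := by
    exact_mod_cast pow_le_factorial_mul_choose n k
  have h3 : (2 : ℝ) ^ k * k.factorial ≤ 2 * k ^ k := by
    exact_mod_cast two_pow_mul_factorial_le k hk
  have hkk : (0 : ℝ) < (k : ℝ) ^ k := by positivity
  refine le_of_mul_le_mul_left ?_ hkk
  set L := Real.log (a * (k : ℝ) + 1) ^ k
  have hL' : 0 ≤ L := pow_nonneg hL k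
  calc (k : ℝ) ^ k * (2 ^ k * Real.log (a * (n : ℝ) + 1) ^ k)
      = 2 ^ k * ((k : ℝ) ^ k * Real.log (a * (n : ℝ) + 1) ^ k) := by ring
    _ ≤ 2 ^ k * ((k.factorial * (n + k).choose k) * L) :=
        mul_le_mul_of_nonneg_left (h1.trans (mul_le_mul_of_nonneg_right h2 hL')) (by positivity)
    _ = (2 ^ k * k.factorial) * ((n + k).choose k * L) := by ring
    _ ≤ (2 * k ^ k) * ((n + k).choose k * L) := by gcongr
    _ = _ := by ring

/-! ### Summability and decay of the error bound -/

theorem abs_coeff_le {a t : ℝ} (ha : 0 < a) (ht : 0 < t) (k n : ℕ) :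
    |coeff a t k n / 3 ^ n| ≤ 2 * boundTerm a k n := by
  have h := abs_eulerStep_phi_le ha ht k n
  rw [coeff_eq, abs_div, abs_mul, abs_pow, abs_neg, abs_one, one_pow, one_mul,
    abs_of_pos (by positivity : (0 : ℝ) < 3 ^ n), boundTerm, div_le_iff₀ (by positivity)]
  refine h.trans (le_of_eq ?_)
  field_simp

theorem boundTerm_nonneg {a : ℝ} (ha : 0 < a) (k n : ℕ) : 0 ≤ boundTerm a k n := by
  have := log_nonneg_of_pos ha (min n k)
  unfold boundTerm
  positivity

theorem boundTerm_le {a : ℝ} (ha : 0 < a) (k n : ℕ) :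
    boundTerm a k n ≤ 1 / 3 ^ n * ((n + k).choose k : ℝ) * Real.log (a * (k : ℝ) + 1) ^ k := by
  have h1 := log_nonneg_of_pos ha (min n k)
  have h2 := log_mono ha (min_le_right n k)
  unfold boundTerm
  gcongr

theorem summable_boundTerm {a : ℝ} (ha : 0 < a) (k : ℕ) : Summable (boundTerm a k) := by
  refine Summable.of_nonneg_of_le (boundTerm_nonneg ha k) (boundTerm_le ha k) ?_
  refine Summable.mul_right _ ?_
  refine (summable_choose_mul_geometric_of_norm_lt_one k (r := (1 / 3 : ℝ)) (by norm_num)).congr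
    fun n => ?_
  rw [one_div_pow, mul_comm]

theorem exists_tsum_boundTerm_le {a : ℝ} (ha : 0 < a) (k : ℕ) :
    ∃ C : ℝ, ∀ N : ℕ, 1 ≤ N →
      ∑' j : ℕ, boundTerm a k (N + j) ≤ C * ((N : ℝ) ^ k * (1 / 3) ^ N) := by
  set L := Real.log (a * (k : ℝ) + 1) ^ k
  have hL : 0 ≤ L := pow_nonneg (log_nonneg_of_pos ha k) k
  have hs : Summable fun j : ℕ => ((j + (k + 1) : ℕ) : ℝ) ^ k * (1 / 3 : ℝ) ^ j := by
    have := (summable_nat_add_iff (k + 1)).2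
      (summable_pow_mul_geometric_of_norm_lt_one (R := ℝ) k (r := (1 / 3 : ℝ)) (by norm_num))
    refine (this.mul_left (3 ^ (k + 1))).congr fun j => ?_
    have h3 : (3 : ℝ) ^ (k + 1) * (1 / 3) ^ (k + 1) = 1 := by rw [← mul_pow]; norm_num
    rw [pow_add (1 / 3 : ℝ)]
    linear_combination ((j + (k + 1) : ℕ) : ℝ) ^ k * (1 / 3 : ℝ) ^ j * h3
  refine ⟨(∑' j : ℕ, ((j + (k + 1) : ℕ) : ℝ) ^ k * (1 / 3 : ℝ) ^ j) * L, fun N hN => ?_⟩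
  have e : (∑' j : ℕ, ((j + (k + 1) : ℕ) : ℝ) ^ k * (1 / 3 : ℝ) ^ j) * L *
      ((N : ℝ) ^ k * (1 / 3) ^ N) = ∑' j : ℕ, (((j + (k + 1) : ℕ) : ℝ) ^ k * (1 / 3 : ℝ) ^ j) *
      (L * ((N : ℝ) ^ k * (1 / 3) ^ N)) := by
    rw [tsum_mul_right, mul_assoc]
  rw [e]
  refine Summable.tsum_le_tsum (fun j => ?_) ?_ (hs.mul_right _)
  · refine (boundTerm_le ha k (N + j)).trans ?_
    have hc : (N + j + k).choose k ≤ (j + (k + 1)) ^ k * N ^ k := by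
      refine (Nat.choose_le_pow _ _).trans ?_
      rw [← mul_pow]
      refine Nat.pow_le_pow_left ?_ k
      -- `N + j + k ≤ (j + k + 1) N` because `N ≥ 1`; this separates `N` from `j`.
      nlinarith
    have hc' : ((N + j + k).choose k : ℝ) ≤ ((j + (k + 1) : ℕ) : ℝ) ^ k * (N : ℝ) ^ k := by
      exact_mod_cast hc
    calc _ ≤ 1 / 3 ^ (N + j) * (((j + (k + 1) : ℕ) : ℝ) ^ k * (N : ℝ) ^ k) * L := by gcongr
      _ = _ := by rw [← one_div_pow, pow_add]; ring
  · exact (summable_boundTerm ha k).comp_injective (add_right_injective N)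

/-! ### The accelerated series: derivatives, sum and tail -/

/-- The accelerated series `(2/3) ∑_n c_{a,t,k}(n) / 3^n`. -/
noncomputable def etaSeries (a : ℝ) (k : ℕ) (t : ℝ) : ℝ := 2 / 3 * ∑' n, coeff a t k n / 3 ^ n

theorem summable_coeff {a t : ℝ} (ha : 0 < a) (ht : 0 < t) (k : ℕ) :
    Summable fun n => coeff a t k n / 3 ^ n :=
  Summable.of_norm_bounded ((summable_boundTerm ha k).mul_left 2) fun n => abs_coeff_le ha ht k n

theorem hasDerivAt_eulerStep_phi {a : ℝ} (ha : 0 < a) (t : ℝ) (k n l : ℕ) :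
    HasDerivAt (fun s => eulerStep^[n] (phi a s k) l) (-eulerStep^[n] (phi a t (k + 1)) l) t := by
  induction n generalizing l with
  | zero =>
    have hl : 0 < a * (l : ℝ) + 1 := by positivity
    have h := ((hasDerivAt_neg t).const_rpow hl).const_mul (Real.log (a * (l : ℝ) + 1) ^ k)
    simp only [Function.iterate_zero, id, phi, div_eq_mul_inv, ← Real.rpow_neg hl.le]
    exact h.congr_deriv (by ring)
  | succ n ih =>
    simp only [Function.iterate_succ_apply', eulerStep]
    exact ((ih l).sub ((ih (l + 1)).const_mul 2)).congr_deriv (by ring)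

theorem hasDerivAt_coeff {a : ℝ} (ha : 0 < a) (t : ℝ) (k n : ℕ) :
    HasDerivAt (fun s => coeff a s k n / 3 ^ n) (coeff a t (k + 1) n / 3 ^ n) t := by
  simp only [coeff_eq]
  exact (((hasDerivAt_eulerStep_phi ha t k n 0).const_mul ((-1) ^ k)).div_const (3 ^ n)).congr_deriv
    (by ring)

theorem hasDerivAt_etaSeries {a t : ℝ} (ha : 0 < a) (ht : 0 < t) (k : ℕ) :
    HasDerivAt (etaSeries a k) (etaSeries a (k + 1) t) t :=
  (hasDerivAt_tsum_of_isPreconnected ((summable_boundTerm ha (k + 1)).mul_left 2) isOpen_Ioi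
    isPreconnected_Ioi (fun n y _ => hasDerivAt_coeff ha y k n)
    (fun n _ hy => abs_coeff_le ha hy (k + 1) n) (Set.mem_Ioi.2 ht)
    (summable_coeff ha ht k) (Set.mem_Ioi.2 ht)).const_mul _

theorem contDiffOn_etaSeries {a : ℝ} (ha : 0 < a) (k : ℕ) :
    ContDiffOn ℝ ∞ (etaSeries a k) (Set.Ioi 0) := by
  refine contDiffOn_infty.2 fun n => ?_
  induction n generalizing k with
  | zero =>
    exact contDiffOn_zero.2 fun t ht =>
      (hasDerivAt_etaSeries ha ht k).continuousAt.continuousWithinAt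
  | succ n ih =>
    rw [Nat.cast_succ, contDiffOn_succ_iff_deriv_of_isOpen isOpen_Ioi]
    exact ⟨fun t ht => (hasDerivAt_etaSeries ha ht k).differentiableAt.differentiableWithinAt,
      fun h => by simp at h, (ih (k + 1)).congr fun t ht => (hasDerivAt_etaSeries ha ht k).deriv⟩

theorem iteratedDeriv_eq_etaSeries {a : ℝ} (ha : 0 < a) {f : ℝ → ℝ}
    (hf : Set.EqOn f (etaSeries a 0) (Set.Ioi 0)) (k : ℕ) :
    Set.EqOn (iteratedDeriv k f) (etaSeries a k) (Set.Ioi 0) := by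
  induction k with
  | zero => simpa using hf
  | succ k ih =>
    intro t ht
    rw [iteratedDeriv_succ, (ih.eventuallyEq_of_mem (Ioi_mem_nhds ht)).deriv_eq]
    exact (hasDerivAt_etaSeries ha ht k).deriv

/-- The accelerated sums `S l` started at `l` solve `S l + S (l + 1) = g l`, so the alternating
partial sums telescope to `S 0 - (-1)^M S M`; the remainder vanishes since `|S M| ≤ g M → 0`. -/
theorem tendsto_etaPartial {a t : ℝ} (ha : 0 < a) (ht : 0 < t) :
    Tendsto (etaPartial a t) atTop (𝓝 (etaSeries a 0 t)) := by
  set g := phi a t 0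
  have hb : ∀ n l, ‖eulerStep^[n] g l / 3 ^ n‖ ≤ g l * (1 / 3) ^ n := fun n l => by
    rw [norm_div, Real.norm_eq_abs, norm_pow, Real.norm_ofNat, one_div_pow, mul_one_div]
    exact div_le_div_of_nonneg_right (abs_eulerStep_phi_zero_le ha ht n l) (by positivity)
  have hgeo : ∀ l, HasSum (fun n => g l * (1 / 3 : ℝ) ^ n) (g l * (3 / 2)) := fun l => by
    rw [show (3 / 2 : ℝ) = (1 - 1 / 3)⁻¹ by norm_num]
    exact (hasSum_geometric_of_lt_one (by norm_num) (by norm_num)).mul_left (g l)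
  have hsum : ∀ l, Summable fun n => eulerStep^[n] g l / 3 ^ n := fun l =>
    Summable.of_norm_bounded (hgeo l).summable fun n => hb n l
  set S : ℕ → ℝ := fun l => 2 / 3 * ∑' n, eulerStep^[n] g l / 3 ^ n with hS
  have hSb : ∀ l, |S l| ≤ g l := fun l => by
    have := tsum_of_norm_bounded (hgeo l) fun n => hb n l
    rw [Real.norm_eq_abs] at this
    rw [hS]
    simp only [abs_mul]
    rw [abs_of_pos (by norm_num : (0 : ℝ) < 2 / 3)]
    linarith
  have hrec : ∀ l, S l + S (l + 1) = g l := fun l => by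
    have h0 := (hsum l).tsum_eq_zero_add
    -- The outermost `T` in `T^(n+1)` is expanded as `1 - 2E`, giving back the series at `l` and at
    -- `l + 1`.
    have h1 : ∑' n, eulerStep^[n + 1] g l / 3 ^ (n + 1) =
        1 / 3 * (∑' n, eulerStep^[n] g l / 3 ^ n) -
          2 / 3 * ∑' n, eulerStep^[n] g (l + 1) / 3 ^ n := by
      rw [← tsum_mul_left, ← tsum_mul_left,
        ← ((hsum l).mul_left _).tsum_sub ((hsum (l + 1)).mul_left _)]
      congr 1
      funext n
      rw [Function.iterate_succ_apply', eulerStep, pow_succ]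
      field_simp
    rw [h1] at h0
    simp only [Function.iterate_zero, id, pow_zero, div_one] at h0
    simp only [hS]
    linarith
  have hpart : ∀ M, etaPartial a t M = S 0 - (-1) ^ M * S M := fun M => by
    induction M with
    | zero => simp [etaPartial]
    | succ M ih =>
      have : g M = 1 / (a * (M : ℝ) + 1) ^ t := by simp [g, phi]
      rw [etaPartial, Finset.sum_range_succ, ← etaPartial, ih, pow_succ, ← mul_one_div, ← this,
        ← hrec M]
      ring
  have hS0 : S 0 = etaSeries a 0 t := by simp [hS, etaSeries, coeff_eq, g]
  have hg : Tendsto g atTop (𝓝 0) := by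
    have h1 : Tendsto (fun l : ℕ => a * (l : ℝ) + 1) atTop atTop :=
      tendsto_atTop_add_const_right _ _ (tendsto_natCast_atTop_atTop.const_mul_atTop ha)
    refine ((tendsto_rpow_atTop ht).comp h1).inv_tendsto_atTop.congr fun l => ?_
    simp [g, phi]
  have hrem : Tendsto (fun M => (-1 : ℝ) ^ M * S M) atTop (𝓝 0) :=
    squeeze_zero_norm (fun M => by simpa [abs_mul] using hSb M) hg
  rw [← hS0, funext hpart]
  simpa using tendsto_const_nhds.sub hrem

theorem abs_etaSeries_sub_etaTrunc_le {a t : ℝ} (ha : 0 < a) (ht : 0 < t) (k N : ℕ) :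
    |etaSeries a k t - etaTrunc a t k N| ≤ 4 / 3 * ∑' j : ℕ, boundTerm a k (N + j) := by
  have hs : Summable fun j => boundTerm a k (N + j) :=
    (summable_boundTerm ha k).comp_injective (add_right_injective N)
  have h := tsum_of_norm_bounded (f := fun j => coeff a t k (N + j) / 3 ^ (N + j))
    (hs.mul_left 2).hasSum fun j => abs_coeff_le ha ht k (N + j)
  rw [tsum_mul_left, Real.norm_eq_abs] at h
  have e := (summable_coeff ha ht k).sum_add_tsum_nat_add N
  simp only [add_comm _ N] at e
  rw [etaSeries, etaTrunc, ← mul_sub, ← e, add_sub_cancel_left, abs_mul,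
    abs_of_pos (by norm_num : (0 : ℝ) < 2 / 3)]
  linarith

end DirichletEta

theorem theorem6p3 (a : ℝ) (ha : 0 < a) (k : ℕ) :
    -- the series defining `η_a` converges on `(0, ∞)` and `η_a` is smooth there,
    -- so that the `k`-th derivative is meaningful
    (∀ t : ℝ, 0 < t →
      Tendsto (DirichletEta.etaPartial a t) atTop (𝓝 (DirichletEta.eta a t))) ∧
    ContDiffOn ℝ ∞ (DirichletEta.eta a) (Set.Ioi 0) ∧
    -- the explicit error bound, by the tail over `n = N + j ≥ N` of a convergent series
    Summable (DirichletEta.boundTerm a k) ∧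
    (∀ t : ℝ, 0 < t → ∀ N : ℕ, 1 ≤ N →
      |iteratedDeriv k (DirichletEta.eta a) t - DirichletEta.etaTrunc a t k N| ≤
        4 / 3 * ∑' j : ℕ, DirichletEta.boundTerm a k (N + j)) ∧
    -- the rate, with a constant depending only on `a` and `k`
    (∃ C : ℝ, ∀ t : ℝ, 0 < t → ∀ N : ℕ, 1 ≤ N →
      |iteratedDeriv k (DirichletEta.eta a) t - DirichletEta.etaTrunc a t k N| ≤
        C * ((N : ℝ) ^ k * (1 / 3) ^ N)) := by
  have hlim : ∀ t : ℝ, 0 < t → DirichletEta.eta a t = DirichletEta.etaSeries a 0 t :=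
    fun t ht => (DirichletEta.tendsto_etaPartial ha ht).limUnder_eq
  have hiter := DirichletEta.iteratedDeriv_eq_etaSeries ha hlim k
  have hbound : ∀ t : ℝ, 0 < t → ∀ N : ℕ, 1 ≤ N →
      |iteratedDeriv k (DirichletEta.eta a) t - DirichletEta.etaTrunc a t k N| ≤
        4 / 3 * ∑' j : ℕ, DirichletEta.boundTerm a k (N + j) := fun t ht N _ => by
    rw [hiter ht]
    exact DirichletEta.abs_etaSeries_sub_etaTrunc_le ha ht k N
  refine ⟨fun t ht => hlim t ht ▸ DirichletEta.tendsto_etaPartial ha ht,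
    (DirichletEta.contDiffOn_etaSeries ha 0).congr hlim, DirichletEta.summable_boundTerm ha k,
    hbound, ?_⟩
  obtain ⟨C, hC⟩ := DirichletEta.exists_tsum_boundTerm_le ha k
  refine ⟨4 / 3 * C, fun t ht N hN => (hbound t ht N hN).trans ?_⟩
  rw [mul_assoc]
  exact mul_le_mul_of_nonneg_left (hC N hN) (by norm_num)
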